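/- For a complex Laurent polynomial $P$ in one variable and an integer $k\ge 0$, let \[ m_k(P)=\int_0^1 \log^k\left|P\left(e^{2\pi i\theta}\right)\right|\,d\theta \] be its $k$-higher Mahler measure, and for integers $b_1,\dots,b_h\ge 2$ let \[ \zeta(b_1,\dots,b_h)=\sum_{0<l_1<\cdots<l_h}\frac{1}{l_1^{b_1}\cdots l_h^{b_h}} \] be the multiple zeta value, with $\zeta()=1$ for $h=0$. Then for every integer $k\ge 0$ the integral defining $m_k(1-x)$ and the series defining the multiple zeta values below converge absolutely, and \[ m_k(1-x)=\sum_{\substack{b_1+\cdots+b_h=k\\ b_i\ge 2}}\frac{(-1)^k\,k!}{2^{2h}}\,\zeta(b_1,\dots,b_h), \] where the sum runs over all compositions (ordered tuples of integers, of any length $h$) of $k$ into parts $b_i\ge 2$; for $k=0$ it consists of the empty composition alone, and for $k=1$ it is empty. -/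

import Mathlib

open scoped Nat

noncomputable section

/-- The value `P(e^{2πiθ})` of a complex Laurent polynomial in one variable. -/
def unitCircleEval (P : LaurentPolynomial ℂ) (θ : ℝ) : ℂ :=
  LaurentPolynomial.eval₂ (RingHom.id ℂ) (Circle.toUnits (Circle.exp (2 * Real.pi * θ))) P

/-- The `k`-higher Mahler measure `m_k(P) = ∫_0^1 log^k |P(e^{2πiθ})| dθ`
of a Laurent polynomial in one variable. -/
def higherMahlerMeasure (k : ℕ) (P : LaurentPolynomial ℂ) : ℝ :=
  ∫ θ in (0 : ℝ)..1, (Real.log ‖unitCircleEval P θ‖) ^ k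

/-- The term `1 / (l_1^{b_1} ⋯ l_h^{b_h})`; an order embedding `Fin h ↪o ℕ+` is a
sequence of integers `0 < l_1 < ⋯ < l_h`. -/
def multizetaTerm {h : ℕ} (b : Fin h → ℕ) (l : Fin h ↪o ℕ+) : ℝ :=
  1 / ∏ i, (((l i : ℕ+) : ℕ) : ℝ) ^ b i

/-- The multiple zeta value
`ζ(b_1, …, b_h) = ∑_{0 < l_1 < ⋯ < l_h} 1 / (l_1^{b_1} ⋯ l_h^{b_h})`. -/
def multizeta {h : ℕ} (b : Fin h → ℕ) : ℝ :=
  ∑' l : Fin h ↪o ℕ+, multizetaTerm b l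

/-- The compositions `b_1 + ⋯ + b_h = k` of `k` (of any length `h`) with all `b_i ≥ 2`. -/
def compositionsTwoLE (k : ℕ) : Finset (Composition k) :=
  Finset.univ.filter fun c => ∀ i, 2 ≤ c.blocksFun i

end

open Filter Topology MeasureTheory

/-! The moment generating function `∫ |1 - x|^s` of `log |1 - x|` has `m_k / k!` as its `k`-th
Taylor coefficient at `0`. A beta integral evaluates it as `Γ(s+1) / Γ(s/2+1)²`
(`integrableOn_norm_one_sub_rpow`), and Euler's limit for `Γ` turns this into `∏ (1 + s²/(4n(n+s)))`
(`tendsto_prod_Gamma`). For `|s| < 1` a geometric series gives `s²/(4n(n+s)) = (1/4) ∑_{b ≥ 2}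
(-s/n)^b`. Multiplying out over finite sets `l_1 < ⋯ < l_h` of indices and collecting powers of `s`
produces the multiple zeta values, each chosen index contributing a factor `1/4`
(`hasSum_mahlerCoeff`). Uniqueness of power series coefficients concludes. -/

theorem HasSum.mul_of_real {ι κ : Type*} {f : ι → ℝ} {g : κ → ℝ} {a b : ℝ}
    (hf : HasSum f a) (hg : HasSum g b) :
    HasSum (fun x : ι × κ => f x.1 * g x.2) (a * b) :=
  hf.mul hg (summable_mul_of_summable_norm hf.summable.norm hg.summable.norm)

theorem HasSum.fin_prod_apply {β : Type*} {h : ℕ} {f : Fin h → β → ℝ} {a : Fin h → ℝ}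
    (hf : ∀ i, HasSum (f i) (a i)) :
    HasSum (fun b : Fin h → β => ∏ i, f i (b i)) (∏ i, a i) := by
  induction h with
  | zero => simp
  | succ h ih =>
    have h1 := ih fun i => hf i.succ
    have h2 := HasSum.mul_of_real (hf 0) h1
    rw [← (Fin.consEquiv fun _ : Fin (h + 1) => β).hasSum_iff, Fin.prod_univ_succ]
    refine Eq.mp (congrArg (fun F => HasSum F _) (funext fun x => ?_)) h2
    simp [Fin.prod_univ_succ, Fin.consEquiv]

/-! ### Expansion of the infinite product as a power series in `s` -/

/-- Finite increasing sequences correspond to finite sets. -/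
noncomputable def orderEmbEquivFinset (α : Type*) [LinearOrder α] : (Σ h : ℕ, (Fin h ↪o α)) ≃ Finset α :=
  Equiv.ofBijective (fun p => Finset.univ.map p.2.toEmbedding) <| by
    constructor
    · rintro ⟨h, l⟩ ⟨h', l'⟩ heq
      have hc : h = h' := by simpa using congrArg Finset.card heq
      subst hc
      have hl : l = l' := by
        rw [Finset.orderEmbOfFin_unique' (s := Finset.univ.map l.toEmbedding) (by simp)
            (f := l) (by intro x; simp),
          Finset.orderEmbOfFin_unique' (s := Finset.univ.map l.toEmbedding) (by simp) (f := l')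
            (by intro x; simp only at heq; rw [heq]; simp)]
      rw [hl]
    · intro T
      exact ⟨⟨T.card, T.orderEmbOfFin rfl⟩, T.map_orderEmbOfFin_univ rfl⟩

/-- The factor attached to an index `n` and an exponent `b` in the expansion of
`∏ (1 + s² / (4n(n+s)))`. -/
noncomputable def mahlerFactor (s : ℝ) (n : ℕ+) (b : ℕ) : ℝ :=
  if 2 ≤ b then (-s / n) ^ b / 4 else 0

theorem hasSum_mahlerFactor {s : ℝ} (hs : |s| < 1) (n : ℕ+) :
    HasSum (mahlerFactor s n) (s ^ 2 / (4 * n * (n + s))) := by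
  have hn : (1 : ℝ) ≤ n := by exact_mod_cast one_le (a := n)
  have hs' := abs_lt.1 hs
  have hr : |-s / (n : ℝ)| < 1 := by
    rw [abs_div, abs_neg, abs_of_pos (by linarith : (0 : ℝ) < n), div_lt_one (by linarith)]
    linarith
  have h1 := ((hasSum_geometric_of_abs_lt_one hr).mul_left ((-s / (n : ℝ)) ^ 2)).div_const 4
  have h3 : (n : ℝ) + s ≠ 0 := by linarith
  have h4 : (n : ℝ) ≠ 0 := by linarith
  have h6 : ∑ b ∈ Finset.range 2, mahlerFactor s n b = 0 := by
    simp [Finset.sum_range_succ, mahlerFactor]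
  have h7 : 1 - -s / (n : ℝ) = (n + s) / n := by field_simp; ring
  rw [← hasSum_nat_add_iff' 2, h6, sub_zero]
  have h8 : (fun b => mahlerFactor s n (b + 2)) =
      fun b => (-s / (n : ℝ)) ^ 2 * (-s / (n : ℝ)) ^ b / 4 := by
    funext b
    simp [mahlerFactor, pow_add, mul_comm]
  have h9 : s ^ 2 / (4 * n * (n + s) : ℝ) = (-s / (n : ℝ)) ^ 2 * (1 - -s / (n : ℝ))⁻¹ / 4 := by
    rw [h7]
    field_simp
  rwa [h8, h9]

/-- Reduces absolute convergence at `s` to the same expansion at `-|s|`, where every term is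
nonnegative and iterated sums suffice. -/
theorem abs_mahlerFactor (s : ℝ) (n : ℕ+) (b : ℕ) :
    |mahlerFactor s n b| = mahlerFactor (-|s|) n b := by
  unfold mahlerFactor
  split_ifs
  · simp [abs_div, abs_pow]
  · simp

theorem summable_sq_div_four_mul {s : ℝ} (hs : |s| < 1) :
    Summable fun n : ℕ+ => s ^ 2 / (4 * n * (n + s) : ℝ) := by
  have h1 : Summable fun n : ℕ+ => s ^ 2 / (4 * (1 - |s|)) * (1 / (n : ℝ) ^ 2) :=
    ((Real.summable_one_div_nat_pow.2 one_lt_two).comp_injective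
      PNat.coe_injective).mul_left _
  refine Summable.of_nonneg_of_le (fun n => ?_) (fun n => ?_) h1
  all_goals
    have hn : (1 : ℝ) ≤ n := by exact_mod_cast one_le (a := n)
    have hs' := neg_abs_le s
    have h0 := abs_nonneg s
  · have : 0 < (n : ℝ) + s := by linarith
    positivity
  · have h2 : 0 < 1 - |s| := by linarith
    rw [div_mul_div_comm, mul_one]
    have h3 : (n : ℝ) * (1 - |s|) ≤ n + s := by nlinarith
    have h4 : 4 * (1 - |s|) * (n : ℝ) ^ 2 ≤ 4 * n * (n + s) := by nlinarith
    gcongr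

theorem summable_prod_sq_div {s : ℝ} (hs : |s| < 1) :
    Summable fun T : Finset ℕ+ => ∏ n ∈ T, s ^ 2 / (4 * n * (n + s) : ℝ) :=
  summable_finsetProd_of_summable_norm (summable_sq_div_four_mul hs).norm

theorem hasSum_sigma_orderEmb {s : ℝ} (hs : |s| < 1) :
    HasSum (fun p : (Σ h : ℕ, (Fin h ↪o ℕ+)) => ∏ i, (s ^ 2 / (4 * p.2 i * (p.2 i + s) : ℝ)))
      (∏' n : ℕ+, (1 + s ^ 2 / (4 * n * (n + s) : ℝ))) := by
  rw [tprod_one_add (summable_prod_sq_div hs)]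
  convert (orderEmbEquivFinset ℕ+).hasSum_iff.2 (summable_prod_sq_div hs).hasSum using 1
  funext p
  change _ = ∏ n ∈ Finset.univ.map p.2.toEmbedding, s ^ 2 / (4 * n * (n + s) : ℝ)
  rw [Finset.prod_map]
  rfl

theorem hasSum_sigma_mahlerFactor {s : ℝ} (hs : |s| < 1) :
    HasSum (fun q : (Σ p : (Σ h : ℕ, (Fin h ↪o ℕ+)), (Fin p.1 → ℕ)) =>
        ∏ i, mahlerFactor s (q.1.2 i) (q.2 i))
      (∏' n : ℕ+, (1 + s ^ 2 / (4 * n * (n + s) : ℝ))) := by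
  have hin : ∀ {s : ℝ} (_ : |s| < 1) (p : Σ h : ℕ, (Fin h ↪o ℕ+)),
      HasSum (fun b : Fin p.1 → ℕ => ∏ i, mahlerFactor s (p.2 i) (b i))
        (∏ i, (s ^ 2 / (4 * p.2 i * (p.2 i + s) : ℝ))) := fun hs p =>
    HasSum.fin_prod_apply fun i => hasSum_mahlerFactor hs (p.2 i)
  have hs' : abs (-|s|) < 1 := by simpa using hs
  have hsum : Summable (fun q : (Σ p : (Σ h : ℕ, (Fin h ↪o ℕ+)), (Fin p.1 → ℕ)) =>
      ∏ i, mahlerFactor s (q.1.2 i) (q.2 i)) := by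
    rw [← summable_abs_iff]
    simp_rw [Finset.abs_prod, abs_mahlerFactor]
    rw [summable_sigma_of_nonneg]
    · refine ⟨fun p => (hin hs' p).summable, ?_⟩
      simp_rw [fun p => (hin hs' p).tsum_eq]
      exact (hasSum_sigma_orderEmb hs').summable
    · intro q
      refine Finset.prod_nonneg fun i _ => ?_
      rw [← abs_mahlerFactor]
      exact abs_nonneg _
  have h1 := hsum.hasSum.sigma (hin hs)
  convert hsum.hasSum using 1
  exact (hasSum_sigma_orderEmb hs).unique h1

theorem HasSum.of_equiv {ι κ : Type*} (e : ι ≃ κ) {f : κ → ℝ} {g : ι → ℝ} {a : ℝ}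
    (hf : HasSum f a) (hg : ∀ x, g x = f (e x)) : HasSum g a := by
  rw [funext hg]
  exact e.hasSum_iff.2 hf

/-- Exchange of the two components of a pair of tuples of the same length. -/
noncomputable def sigmaTupleComm : (Σ p : (Σ h : ℕ, (Fin h → ℕ)), (Fin p.1 ↪o ℕ+)) ≃
    (Σ p : (Σ h : ℕ, (Fin h ↪o ℕ+)), (Fin p.1 → ℕ)) where
  toFun q := ⟨⟨q.1.1, q.2⟩, q.1.2⟩
  invFun q := ⟨⟨q.1.1, q.2⟩, q.1.2⟩
  left_inv _ := rfl
  right_inv _ := rfl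

/-- Replace a list of exponents by its length and its entries. -/
noncomputable def sigmaListEquiv : (Σ L : List ℕ, (Fin L.length ↪o ℕ+)) ≃
    (Σ p : (Σ h : ℕ, (Fin h → ℕ)), (Fin p.1 ↪o ℕ+)) :=
  Equiv.sigmaCongrLeft (β := fun p : (Σ h : ℕ, (Fin h → ℕ)) => (Fin p.1 ↪o ℕ+))
    List.equivSigmaTuple

theorem sigmaListEquiv_apply (q : Σ L : List ℕ, (Fin L.length ↪o ℕ+)) :
    sigmaListEquiv q = ⟨⟨q.1.length, q.1.get⟩, q.2⟩ := rfl

/-- Puts the exponents outermost, so that the inner sum over `l` is a multiple zeta value and the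
lists can be grouped by their sum. -/
theorem hasSum_list_mahlerFactor {s : ℝ} (hs : |s| < 1) :
    HasSum (fun q : (Σ L : List ℕ, (Fin L.length ↪o ℕ+)) =>
        ∏ i, mahlerFactor s (q.2 i) (q.1.get i))
      (∏' n : ℕ+, (1 + s ^ 2 / (4 * n * (n + s) : ℝ))) := by
  refine HasSum.of_equiv (sigmaListEquiv.trans sigmaTupleComm) (hasSum_sigma_mahlerFactor hs) ?_
  intro q
  rw [Equiv.trans_apply, sigmaListEquiv_apply]
  rfl

theorem prod_mahlerFactor_of_two_le (s : ℝ) {L : List ℕ} (hL : ∀ i, 2 ≤ L.get i)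
    (l : Fin L.length ↪o ℕ+) :
    ∏ i, mahlerFactor s (l i) (L.get i) =
      (-s) ^ L.sum / 2 ^ (2 * L.length) * multizetaTerm L.get l := by
  have h1 : L.sum = ∑ i, L.get i := by
    conv_lhs => rw [← List.ofFn_get L, List.sum_ofFn]
  simp_rw [mahlerFactor, if_pos (hL _), multizetaTerm, Finset.prod_div_distrib, div_pow,
    Finset.prod_div_distrib, Finset.prod_pow_eq_pow_sum, ← h1]
  rw [pow_mul]
  simp
  norm_num
  ring

/-- For fixed exponents the terms are, up to a nonzero constant, a slice of the summable family
above; any nonzero `s` with `|s| < 1` would do. -/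
theorem summable_multizetaTerm {L : List ℕ} (hL : ∀ i, 2 ≤ L.get i) :
    Summable (multizetaTerm L.get) := by
  have h1 := (hasSum_list_mahlerFactor (s := 1 / 2) (by norm_num [abs_lt])).summable.sigma_factor L
  simp only [prod_mahlerFactor_of_two_le _ hL] at h1
  rwa [summable_mul_left_iff] at h1
  refine div_ne_zero (pow_ne_zero _ (by norm_num)) (by positivity)

/-- The coefficient of `s ^ k` in the expansion of `∏ (1 + s² / (4n(n+s)))`. -/
noncomputable def mahlerCoeff (k : ℕ) : ℝ :=
  ∑ c ∈ compositionsTwoLE k, (-1 : ℝ) ^ k / 2 ^ (2 * c.length) * multizeta c.blocksFun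

theorem hasSum_mahlerCoeff {s : ℝ} (hs : |s| < 1) :
    HasSum (fun k => s ^ k * mahlerCoeff k)
      (∏' n : ℕ+, (1 + s ^ 2 / (4 * n * (n + s) : ℝ))) := by
  have h0 := hasSum_list_mahlerFactor hs
  have h1 := h0.sigma fun L => (h0.summable.sigma_factor L).hasSum
  rw [← (Equiv.sigmaFiberEquiv (List.sum : List ℕ → ℕ)).hasSum_iff] at h1
  refine h1.sigma fun k => ?_
  change HasSum (fun L : {L : List ℕ // L.sum = k} =>
    ∑' l : Fin L.1.length ↪o ℕ+, ∏ i, mahlerFactor s (l i) (L.1.get i)) _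
  set emb : Composition k → {L : List ℕ // L.sum = k} := fun c => ⟨c.blocks, c.blocks_sum⟩
  have hemb : Function.Injective emb := fun c d h => Composition.ext (congrArg Subtype.val h)
  have hzero : ∀ L : List ℕ, (¬ ∀ i, 2 ≤ L.get i) →
      ∑' l : Fin L.length ↪o ℕ+, ∏ i, mahlerFactor s (l i) (L.get i) = 0 := by
    intro L hL
    push Not at hL
    obtain ⟨i, hi⟩ := hL
    have : ∀ l : Fin L.length ↪o ℕ+, ∏ i, mahlerFactor s (l i) (L.get i) = 0 := fun l =>
      Finset.prod_eq_zero (Finset.mem_univ i) (if_neg hi.not_ge)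
    simp_rw [this, tsum_zero]
  rw [← hemb.hasSum_iff]
  · convert hasSum_fintype _ using 1
    rw [mahlerCoeff, compositionsTwoLE, Finset.sum_filter, Finset.mul_sum]
    refine Finset.sum_congr rfl fun c _ => ?_
    split_ifs with hc
    · change _ = ∑' l : Fin c.blocks.length ↪o ℕ+, ∏ i, mahlerFactor s (l i) (c.blocks.get i)
      simp_rw [prod_mahlerFactor_of_two_le s (L := c.blocks) hc]
      rw [tsum_mul_left, c.blocks_sum, multizeta, neg_pow s]
      change _ = _ * ∑' l, multizetaTerm c.blocks.get l
      change s ^ k * ((-1) ^ k / 2 ^ (2 * c.blocks.length) * ∑' l, multizetaTerm c.blocks.get l) = _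
      ring
    · rw [mul_zero]
      exact (hzero c.blocks hc).symm
  -- A list with sum `k` that is not a composition has an entry `0`, so its contribution vanishes.
  · rintro ⟨L, hL⟩ hr
    refine hzero L fun h => hr ⟨⟨L, ?_, hL⟩, rfl⟩
    intro i hi
    obtain ⟨j, rfl⟩ := List.get_of_mem hi
    exact lt_of_lt_of_le two_pos (h j)

/-! ### The integral of `|1 - x|^s` as a beta integral -/

theorem norm_unitCircleEval_one_sub_T (θ : ℝ) :
    ‖unitCircleEval (1 - LaurentPolynomial.T 1) θ‖ = |2 * Real.sin (Real.pi * θ)| := by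
  have h := Complex.norm_exp_I_mul_ofReal_sub_one (2 * Real.pi * θ)
  rw [unitCircleEval, map_sub, map_one, LaurentPolynomial.eval₂_T, norm_sub_rev]
  have h2 : 2 * Real.pi * θ / 2 = Real.pi * θ := by ring
  rw [h2, Real.norm_eq_abs] at h
  rw [← h, zpow_one, mul_comm Complex.I]
  simp [Circle.toUnits_apply]

theorem norm_unitCircleEval_one_sub_T_of_mem {θ : ℝ} (hθ : θ ∈ Set.Ioo (0 : ℝ) 1) :
    0 < Real.sin (Real.pi / 2 * θ) ∧ 0 < Real.cos (Real.pi / 2 * θ) ∧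
    ‖unitCircleEval (1 - LaurentPolynomial.T 1) θ‖ =
      4 * (Real.sin (Real.pi / 2 * θ) * Real.cos (Real.pi / 2 * θ)) := by
  have hpi := Real.pi_pos
  have h1 : 0 < Real.pi / 2 * θ := mul_pos (by positivity) hθ.1
  have h2 : Real.pi / 2 * θ < Real.pi / 2 := by nlinarith [hθ.2]
  have hs := Real.sin_pos_of_pos_of_lt_pi h1 (by linarith)
  have hc := Real.cos_pos_of_mem_Ioo ⟨by linarith, h2⟩
  refine ⟨hs, hc, ?_⟩
  rw [norm_unitCircleEval_one_sub_T, show Real.pi * θ = 2 * (Real.pi / 2 * θ) by ring,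
    Real.sin_two_mul, abs_of_pos (by positivity)]
  ring

theorem Real.integrableOn_betaIntegrand {u v : ℝ} (hu : 0 < u) (hv : 0 < v) :
    IntegrableOn (fun x : ℝ => x ^ (u - 1) * (1 - x) ^ (v - 1)) (Set.Ioo 0 1) ∧
    ∫ x in Set.Ioo (0 : ℝ) 1, x ^ (u - 1) * (1 - x) ^ (v - 1) =
      Real.Gamma u * Real.Gamma v / Real.Gamma (u + v) := by
  have h0 : ∀ x ∈ Set.Ioo (0 : ℝ) 1,
      (x : ℂ) ^ ((u : ℂ) - 1) * (1 - (x : ℂ)) ^ ((v : ℂ) - 1) =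
        ((x ^ (u - 1) * (1 - x) ^ (v - 1) : ℝ) : ℂ) := by
    intro x hx
    rw [Complex.ofReal_mul, Complex.ofReal_cpow hx.1.le, Complex.ofReal_cpow (by linarith [hx.2])]
    push_cast
    rfl
  have h1 := Complex.betaIntegral_convergent (u := u) (v := v) (by simpa) (by simpa)
  rw [intervalIntegrable_iff_integrableOn_Ioo_of_le zero_le_one,
    integrableOn_congr_fun h0 measurableSet_Ioo] at h1
  have h2 := Complex.betaIntegral_eq_Gamma_mul_div u v (by simpa) (by simpa)
  rw [Complex.betaIntegral, intervalIntegral.integral_of_le zero_le_one,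
    integral_Ioc_eq_integral_Ioo, setIntegral_congr_fun measurableSet_Ioo h0,
    integral_complex_ofReal, ← Complex.ofReal_add, Complex.Gamma_ofReal, Complex.Gamma_ofReal,
    Complex.Gamma_ofReal] at h2
  refine ⟨by simpa [IntegrableOn] using h1.re, by exact_mod_cast h2⟩

theorem integrableOn_norm_one_sub_rpow {s : ℝ} (hs : -1 < s) :
    IntegrableOn (fun θ => ‖unitCircleEval (1 - LaurentPolynomial.T 1) θ‖ ^ s) (Set.Ioo 0 1) ∧
    ∫ θ in Set.Ioo (0 : ℝ) 1, ‖unitCircleEval (1 - LaurentPolynomial.T 1) θ‖ ^ s =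
      Real.Gamma (s + 1) / Real.Gamma (s / 2 + 1) ^ 2 := by
  have hpi := Real.pi_pos
  -- Substitute `sin²(πθ/2)` in the beta integral `B(a, a)`. With `u`, `v` the sine and cosine, the
  -- integrand becomes `π (uv)^(1 + 2(a-1))`; this `a` makes the exponent `s`, and `|1 - x| = 4uv`.
  set a : ℝ := (s + 1) / 2 with ha
  have ha0 : 0 < a := by rw [ha]; linarith
  set f : ℝ → ℝ := fun θ => Real.sin (Real.pi / 2 * θ) ^ 2 with hf
  set f' : ℝ → ℝ := fun θ =>
    Real.pi * (Real.sin (Real.pi / 2 * θ) * Real.cos (Real.pi / 2 * θ)) with hf'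
  have hderiv : ∀ θ ∈ Set.Ioo (0 : ℝ) 1, HasDerivWithinAt f (f' θ) (Set.Ioo 0 1) θ := by
    intro θ _
    have := (((hasDerivAt_id θ).const_mul (Real.pi / 2)).sin.pow 2)
    refine (this.congr_deriv ?_).hasDerivWithinAt
    simp [hf']
    ring
  have hmono : StrictMonoOn f (Set.Icc 0 1) := by
    intro x hx y hy hxy
    have h1 : Real.sin (Real.pi / 2 * x) < Real.sin (Real.pi / 2 * y) :=
      Real.strictMonoOn_sin ⟨by nlinarith [hx.1], by nlinarith [hx.2]⟩
        ⟨by nlinarith [hy.1], by nlinarith [hy.2]⟩ (by gcongr)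
    have h2 : 0 ≤ Real.sin (Real.pi / 2 * x) :=
      Real.sin_nonneg_of_nonneg_of_le_pi (by nlinarith [hx.1]) (by nlinarith [hx.2])
    exact pow_lt_pow_left₀ h1 h2 two_ne_zero
  have hinj : Set.InjOn f (Set.Ioo 0 1) := (hmono.mono Set.Ioo_subset_Icc_self).injOn
  have himg : f '' Set.Ioo 0 1 = Set.Ioo 0 1 := by
    have hf0 : f 0 = 0 := by simp [hf]
    have hf1 : f 1 = 1 := by simp [hf]
    apply Set.Subset.antisymm
    · rintro _ ⟨θ, hθ, rfl⟩
      have hm := Set.Ioo_subset_Icc_self hθ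
      constructor
      · rw [← hf0]; exact hmono (by simp) hm hθ.1
      · rw [← hf1]; exact hmono hm (by simp) hθ.2
    · have hc : ContinuousOn f (Set.Icc 0 1) := by fun_prop
      have := intermediate_value_Ioo zero_le_one hc
      rwa [hf0, hf1] at this
  have hG : ∀ θ ∈ Set.Ioo (0 : ℝ) 1,
      |f' θ| • ((f θ) ^ (a - 1) * (1 - f θ) ^ (a - 1)) =
        Real.pi * 4 ^ (-s) * ‖unitCircleEval (1 - LaurentPolynomial.T 1) θ‖ ^ s := by
    intro θ hθ
    obtain ⟨hs0, hc0, hn⟩ := norm_unitCircleEval_one_sub_T_of_mem hθ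
    have h1 : 1 - f θ = Real.cos (Real.pi / 2 * θ) ^ 2 := by
      rw [hf]; linarith [Real.sin_sq_add_cos_sq (Real.pi / 2 * θ)]
    rw [hn, h1]
    simp only [hf, hf', smul_eq_mul]
    set u := Real.sin (Real.pi / 2 * θ)
    set v := Real.cos (Real.pi / 2 * θ)
    have huv : 0 < u * v := mul_pos hs0 hc0
    rw [abs_of_pos (by positivity), ← Real.mul_rpow (by positivity) (by positivity), ← mul_pow,
      Real.mul_rpow (by norm_num) huv.le, Real.rpow_neg (by norm_num), ← Real.rpow_natCast,
      ← Real.rpow_mul huv.le, mul_assoc Real.pi]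
    nth_rewrite 1 [← Real.rpow_one (u * v)]
    rw [← Real.rpow_add huv, show (1 : ℝ) + ((2 : ℕ) : ℝ) * (a - 1) = s by rw [ha]; push_cast; ring]
    have h4 : (4 : ℝ) ^ s ≠ 0 := by positivity
    field_simp
  obtain ⟨hi, hv⟩ := Real.integrableOn_betaIntegrand ha0 ha0
  have hK : Real.pi * (4 : ℝ) ^ (-s) ≠ 0 := by positivity
  constructor
  · rw [← himg, integrableOn_image_iff_integrableOn_abs_deriv_smul measurableSet_Ioo hderiv hinj,
      integrableOn_congr_fun hG measurableSet_Ioo] at hi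
    simpa [IntegrableOn, integrable_const_mul_iff hK.isUnit] using hi
  · rw [← himg, integral_image_eq_integral_abs_deriv_smul measurableSet_Ioo hderiv hinj,
      setIntegral_congr_fun measurableSet_Ioo hG, integral_const_mul] at hv
    -- Legendre duplication trades `Γ(a)` for `Γ(s+1) / Γ(s/2+1)`.
    have hdup := Real.Gamma_mul_Gamma_add_half a
    rw [show a + 1 / 2 = s / 2 + 1 by rw [ha]; ring, show 2 * a = s + 1 by rw [ha]; ring,
      show 1 - (s + 1) = -s by ring] at hdup
    rw [show a + a = s + 1 by rw [ha]; ring] at hv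
    have hg1 : 0 < Real.Gamma (s + 1) := Real.Gamma_pos_of_pos (by linarith)
    have hg2 : 0 < Real.Gamma (s / 2 + 1) := Real.Gamma_pos_of_pos (by linarith)
    have h5 : (4 : ℝ) ^ (-s) = (2 ^ (-s)) ^ 2 := by
      rw [← Real.rpow_natCast, ← Real.rpow_mul (by norm_num), mul_comm,
        Real.rpow_mul (by norm_num)]
      norm_num
    have h6 : √Real.pi ^ 2 = Real.pi := Real.sq_sqrt hpi.le
    rw [← mul_right_inj' hK, hv, h5]
    rw [← eq_div_iff hg2.ne'] at hdup
    rw [hdup]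
    field_simp
    rw [h6]

/-! ### The Gamma quotient as an infinite product -/

theorem tendsto_prod_Gamma {s : ℝ} (hs : -1 < s) :
    Tendsto (fun N => ∏ j ∈ Finset.range N, (1 + s ^ 2 / (4 * (j + 1) * (j + 1 + s))))
      atTop (𝓝 (Real.Gamma (s + 1) / Real.Gamma (s / 2 + 1) ^ 2)) := by
  have hg2 : 0 < Real.Gamma (s / 2 + 1) := Real.Gamma_pos_of_pos (by linarith)
  have h1 := (Real.GammaSeq_tendsto_Gamma (s + 1)).div
    ((Real.GammaSeq_tendsto_Gamma (s / 2 + 1)).pow 2) (by positivity)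
  -- The quotient of the Euler sequences at `n` differs from the product of the first `n + 1`
  -- factors exactly by `n / (n + 1)`.
  have h2 := h1.mul (tendsto_natCast_div_add_atTop (1 : ℝ))
  rw [mul_one] at h2
  rw [← tendsto_add_atTop_iff_nat 1]
  refine h2.congr' ?_
  filter_upwards [eventually_gt_atTop 0] with n hn
  have hn0 : (0 : ℝ) < n := by exact_mod_cast hn
  have hA : ∀ j : ℕ, 0 < s + 1 + j := fun j => by
    have : (0 : ℝ) ≤ j := j.cast_nonneg
    linarith
  have hB : ∀ j : ℕ, 0 < s / 2 + 1 + j := fun j => by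
    have : (0 : ℝ) ≤ j := j.cast_nonneg
    linarith
  have hA' := Finset.prod_pos fun j (_ : j ∈ Finset.range (n + 1)) => hA j
  have hB' := Finset.prod_pos fun j (_ : j ∈ Finset.range (n + 1)) => hB j
  have hfac : ∏ j ∈ Finset.range (n + 1), ((j : ℝ) + 1) = (n + 1) * n ! := by
    have := Finset.prod_range_add_one_eq_factorial (n + 1)
    rw [Nat.factorial_succ] at this
    exact_mod_cast this
  have hterm : ∀ j : ℕ, 1 + s ^ 2 / (4 * (j + 1) * (j + 1 + s)) =
      (s / 2 + 1 + j) ^ 2 / ((j + 1) * (s + 1 + j)) := fun j => by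
    have := hA j
    have h3 : (j : ℝ) + 1 + s ≠ 0 := by linarith
    have h4 : s + 1 + (j : ℝ) ≠ 0 := by linarith
    have h5 : (j : ℝ) + 1 ≠ 0 := by positivity
    rw [show (j : ℝ) + 1 + s = s + 1 + j by ring]
    field_simp
    ring
  simp_rw [hterm, Finset.prod_div_distrib, Finset.prod_mul_distrib, Finset.prod_pow, hfac]
  have hp : (n : ℝ) ^ (s + 1) * n = ((n : ℝ) ^ (s / 2 + 1)) ^ 2 := by
    rw [← Real.rpow_natCast, ← Real.rpow_mul hn0.le]
    nth_rewrite 2 [← Real.rpow_one (n : ℝ)]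
    rw [← Real.rpow_add hn0]
    congr 1
    push_cast
    ring
  have hp0 : (n : ℝ) ^ (s / 2 + 1) ≠ 0 := by positivity
  have hf0 : (n ! : ℝ) ≠ 0 := by positivity
  simp only [Pi.div_apply, Real.GammaSeq]
  have : (n : ℝ) ^ (s + 1) = ((n : ℝ) ^ (s / 2 + 1)) ^ 2 / n := by
    rw [← hp]; field_simp
  rw [this]
  field_simp

theorem tprod_one_add_sq_div_eq_Gamma {s : ℝ} (hs : |s| < 1) :
    ∏' n : ℕ+, (1 + s ^ 2 / (4 * n * (n + s) : ℝ)) =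
      Real.Gamma (s + 1) / Real.Gamma (s / 2 + 1) ^ 2 := by
  have h1 := hasProd_one_add_of_hasSum_prod (summable_prod_sq_div hs).hasSum
  have h2 := ((Equiv.pnatEquivNat.symm.hasProd_iff
    (f := fun n : ℕ+ => 1 + s ^ 2 / (4 * n * (n + s) : ℝ))).2 h1).tendsto_prod_nat
  rw [h1.tprod_eq]
  refine tendsto_nhds_unique h2 ((tendsto_prod_Gamma (abs_lt.1 hs).1).congr fun N => ?_)
  refine Finset.prod_congr rfl fun j _ => ?_
  simp [Equiv.pnatEquivNat]

/-! ### Comparison of Taylor coefficients -/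

/-- The logarithm of `|1 - x|` at `x = e^{2πiθ}`. -/
noncomputable def logNormOneSub (θ : ℝ) : ℝ :=
  Real.log ‖unitCircleEval (1 - LaurentPolynomial.T 1) θ‖

theorem exp_mul_logNormOneSub {θ : ℝ} (hθ : θ ∈ Set.Ioo (0 : ℝ) 1) (s : ℝ) :
    Real.exp (s * logNormOneSub θ) = ‖unitCircleEval (1 - LaurentPolynomial.T 1) θ‖ ^ s := by
  obtain ⟨hs0, hc0, hn⟩ := norm_unitCircleEval_one_sub_T_of_mem hθ
  rw [Real.rpow_def_of_pos (by rw [hn]; positivity), mul_comm, logNormOneSub]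

/-- Exponential integrability on both sides of `0` makes all moments finite and the generating
function analytic there. -/
theorem zero_mem_interior_integrableExpSet :
    0 ∈ interior (ProbabilityTheory.integrableExpSet logNormOneSub
      (volume.restrict (Set.Ioo 0 1))) := by
  rw [mem_interior]
  refine ⟨Set.Ioi (-1), fun s hs => ?_, isOpen_Ioi, by simp⟩
  exact (integrableOn_congr_fun (fun θ hθ => exp_mul_logNormOneSub hθ s) measurableSet_Ioo).2
    (integrableOn_norm_one_sub_rpow hs).1

theorem mgf_logNormOneSub {s : ℝ} (hs : -1 < s) :
    ProbabilityTheory.mgf logNormOneSub (volume.restrict (Set.Ioo 0 1)) s =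
      Real.Gamma (s + 1) / Real.Gamma (s / 2 + 1) ^ 2 := by
  rw [← (integrableOn_norm_one_sub_rpow hs).2]
  exact setIntegral_congr_fun measurableSet_Ioo fun θ hθ => exp_mul_logNormOneSub hθ s

theorem integral_logNormOneSub_pow (k : ℕ) :
    ∫ θ in Set.Ioo (0 : ℝ) 1, logNormOneSub θ ^ k = k ! * mahlerCoeff k := by
  have h1 := ProbabilityTheory.hasFPowerSeriesAt_mgf zero_mem_interior_integrableExpSet
  have h2 : HasFPowerSeriesAt
      (ProbabilityTheory.mgf logNormOneSub (volume.restrict (Set.Ioo 0 1)))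
      (FormalMultilinearSeries.ofScalars ℝ mahlerCoeff) 0 := by
    rw [hasFPowerSeriesAt_iff]
    filter_upwards [Ioo_mem_nhds (show (-1 : ℝ) < 0 by norm_num) one_pos] with s hs
    rw [zero_add, mgf_logNormOneSub hs.1, ← tprod_one_add_sq_div_eq_Gamma (abs_lt.2 hs)]
    simpa [FormalMultilinearSeries.coeff_ofScalars] using hasSum_mahlerCoeff (abs_lt.2 hs)
  have h3 := congrArg (fun p => FormalMultilinearSeries.coeff p k)
    (h1.eq_formalMultilinearSeries h2)
  simp only [FormalMultilinearSeries.coeff_ofScalars, zero_mul, Real.exp_zero, mul_one] at h3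
  rw [← h3]
  field_simp

theorem mainTheorem1 (k : ℕ) :
    IntervalIntegrable
      (fun θ : ℝ => (Real.log ‖unitCircleEval (1 - LaurentPolynomial.T 1) θ‖) ^ k)
      MeasureTheory.volume 0 1 ∧
    (∀ c ∈ compositionsTwoLE k, Summable (multizetaTerm c.blocksFun)) ∧
    higherMahlerMeasure k (1 - LaurentPolynomial.T 1) =
      ∑ c ∈ compositionsTwoLE k,
        ((-1 : ℝ) ^ k * (k ! : ℝ) / 2 ^ (2 * c.length)) * multizeta c.blocksFun := by
  refine ⟨?_, fun c hc => ?_, ?_⟩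
  · rw [intervalIntegrable_iff_integrableOn_Ioo_of_le zero_le_one]
    exact ProbabilityTheory.integrable_pow_of_mem_interior_integrableExpSet
      zero_mem_interior_integrableExpSet k
  · exact summable_multizetaTerm (L := c.blocks) (Finset.mem_filter.1 hc).2
  · rw [higherMahlerMeasure, intervalIntegral.integral_of_le zero_le_one,
      integral_Ioc_eq_integral_Ioo]
    refine (integral_logNormOneSub_pow k).trans ?_
    rw [mahlerCoeff, Finset.mul_sum]
    refine Finset.sum_congr rfl fun c _ => ?_
    ring
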